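/- A standard space is a locally compact separable metrizable space. A surjective map $q:Y\to X$ from a topological space $Y$ is irreducible if no proper closed subset of $Y$ is mapped onto $X$ by $q$. For $Y$ standard, let $\mathrm{Cl}(Y)$ be the set of closed subsets of $Y$ with the Fell topology, generated by the sets $\{F: F\cap K=\emptyset\}$ ($K\subseteq Y$ compact) and $\{F: F\cap U\neq\emptyset\}$ ($U\subseteq Y$ open). For a quotient map $q:Y\to X$ from a standard space to a Hausdorff space, let $Y_*$ be the space of all non-empty $F\in \mathrm{Cl}(Y)$ that lie in the closure of the set of fibres $\{q^{-1}(x): x\in X\}$, with the subspace topology. Since $X$ is Hausdorff, $q$ is constant on each $F\in Y_*$, and $q_*:Y_*\to X$ is defined by $q_*(F)=q(y)$ for $y\in F$. A subset $E\subseteq X$ is sequentially dense if every point of $X$ is the limit of a sequence in $E$. A point $x\in X$ is of compact type if there is a compact set $K\subseteq X$ such that every sequence in $X$ converging to $x$ is eventually in $K$. For $E\subseteq X$ consider the following properties. (a) Whenever $(x_m)$ is a sequence of distinct points of $E$ with limit $x_0\in X$, there is a subsequence $(x_n)$ such that for all sequences $(x_n^j)_j$ in $X$ with $x_n^j\to x_n$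 as $j\to\infty$ $(n\ge 1)$ there are natural numbers $k_n$ such that $\{x_n^j: n\ge 1,\ j\ge k_n\}$ has compact closure in $X$. (b) Whenever $(x_m)$ is a sequence of distinct points of $X$ with limit $x_0\in X$, there are a subsequence $(x_n)$ and sequences $(x_n^j)_j$ in $E$ with $x_n^j\to x_n$ as $j\to\infty$ $(n\ge 1)$ such that every diagonal sequence $(x_n^{j(n)})_n$, with $j:\mathbb N\to\mathbb N$ arbitrary, converges to $x_0$. **Corollary 5.5.** Let $X$ be a Hausdorff space that is the image of a standard space under a quotient map. Then the following are equivalent: (i) $X$ is the image of an irreducible quotient map from a standard space; (ii) $X$ has a sequentially dense subset $E$, all of whose points are of compact type in $X$, with properties (a) and (b); (iii) for every quotient map $q:Y\to X$ from a standard space $Y$, if $V$ denotes the closure in $Y_*$ of the set of those $z\in Y_*$ with $q_*^{-1}(q_*(z))=\{z\}$ (the singleton fibres of $Y_*$), then the restriction $q_*|V:V\to X$ is an irreducible quotient map onto $X$. -/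

import Mathlib

open Set Filter Topology

universe u v

/-- A standard space: a locally compact separable metric space (as a topological space). -/
structure IsStandardSpace (Y : Type v) [TopologicalSpace Y] : Prop where
  locallyCompact : LocallyCompactSpace Y
  separable : TopologicalSpace.SeparableSpace Y
  metrizable : TopologicalSpace.MetrizableSpace Y

/-- A surjective map is irreducible if no proper closed subset of its domain is mapped onto the
whole codomain. -/
def IsIrreducibleMap {Y : Type v} {X : Type u} [TopologicalSpace Y] (q : Y → X) : Prop :=
  Function.Surjective q ∧ ∀ C : Set Y, IsClosed C → q '' C = univ → C = univ

/-- The points whose fibre is a singleton. -/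
def singletonFibres {Y : Type v} {X : Type u} (q : Y → X) : Set Y :=
  {y | q ⁻¹' {q y} = {y}}

/-- The set of all closed subsets of `Y` (a copy of `Closeds Y`, which will carry the Fell
topology). -/
def FellCloseds (Y : Type v) [TopologicalSpace Y] : Type v :=
  TopologicalSpace.Closeds Y

/-- The underlying subset of `Y`. -/
def FellCloseds.toSet {Y : Type v} [TopologicalSpace Y] (F : FellCloseds Y) : Set Y :=
  TopologicalSpace.Closeds.carrier F

/-- The Fell topology: generated by the sets `{F | F ∩ K = ∅}` with `K` compact and
`{F | F ∩ U ≠ ∅}` with `U` open. -/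
instance FellCloseds.instTopologicalSpace (Y : Type v) [TopologicalSpace Y] :
    TopologicalSpace (FellCloseds Y) :=
  TopologicalSpace.generateFrom
    ({S | ∃ K : Set Y, IsCompact K ∧ S = {F | F.toSet ∩ K = ∅}} ∪
      {S | ∃ U : Set Y, IsOpen U ∧ S = {F | (F.toSet ∩ U).Nonempty}})

/-- The set of fibres of `q`, as a subset of the Fell hyperspace. -/
def fibreSet {Y : Type v} {X : Type u} [TopologicalSpace Y] (q : Y → X) : Set (FellCloseds Y) :=
  {F | ∃ y : Y, F.toSet = q ⁻¹' {q y}}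

/-- The space `Y_*`: the nonempty closed sets that lie in the Fell closure of the set of fibres
(with the subspace topology). The empty set, which plays the role of the point at infinity, is
excluded. -/
def fellStar {Y : Type v} {X : Type u} [TopologicalSpace Y] (q : Y → X) : Set (FellCloseds Y) :=
  {F | F ∈ closure (fibreSet q) ∧ F.toSet.Nonempty}

/-- The map `q_* : Y_* → X`, sending `F` to the value of `q` at a point of `F`; see `qStar_eq`
for the independence of the chosen point. -/
noncomputable def qStar {Y : Type v} {X : Type u} [TopologicalSpace Y] (q : Y → X)
    (F : fellStar q) : X :=
  q F.2.2.some

/-- If `q` is continuous into a Hausdorff space, then `q` is constant on each `F ∈ Y_*`, so that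
`q_*(F) = q(y)` for all `y ∈ F`. -/
theorem qStar_eq {Y : Type v} {X : Type u} [TopologicalSpace Y] [TopologicalSpace X] [T2Space X]
    {q : Y → X} (hq : Continuous q) (F : fellStar q) {y : Y} (hy : y ∈ F.1.toSet) :
    qStar q F = q y := by
  by_contra hne
  obtain ⟨U, W, hU, hW, hxU, hyW, hd⟩ := t2_separation hne
  have hopen : ∀ O : Set X, IsOpen O →
      IsOpen {G : FellCloseds Y | (G.toSet ∩ q ⁻¹' O).Nonempty} := fun O hO =>
    TopologicalSpace.isOpen_generateFrom_of_mem (Or.inr ⟨_, hO.preimage hq, rfl⟩)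
  obtain ⟨G, ⟨⟨a, haG, haU⟩, ⟨b, hbG, hbW⟩⟩, ⟨x, hG⟩⟩ :=
    mem_closure_iff.1 F.2.1 _ ((hopen U hU).inter (hopen W hW))
      ⟨⟨_, F.2.2.some_mem, hxU⟩, ⟨y, hy, hyW⟩⟩
  rw [hG] at haG hbG
  have hab : q a = q b := by
    rw [mem_preimage, mem_singleton_iff] at haG hbG
    rw [haG, hbG]
  exact Set.disjoint_left.1 hd haU (by rw [hab]; exact hbW)

/-- The closure `V`, in `Y_*`, of the set of singleton fibres of `q_* : Y_* → X`. -/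
def singletonClosure {Y : Type v} {X : Type u} [TopologicalSpace Y] (q : Y → X) :
    Set (fellStar q) :=
  closure (singletonFibres (qStar q))

/-- `E` is sequentially dense: every point is the limit of a sequence in `E`. -/
def SequentiallyDense {X : Type u} [TopologicalSpace X] (E : Set X) : Prop :=
  ∀ x : X, ∃ s : ℕ → X, (∀ n, s n ∈ E) ∧ Tendsto s atTop (𝓝 x)

/-- `x` is a point of compact type: some compact set eventually contains every sequence
converging to `x`. -/
def IsCompactTypePoint {X : Type u} [TopologicalSpace X] (x : X) : Prop :=
  ∃ K : Set X, IsCompact K ∧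
    ∀ s : ℕ → X, Tendsto s atTop (𝓝 x) → ∀ᶠ n in atTop, s n ∈ K

/-- Property (a): every convergent sequence of distinct points of `E` has a subsequence `(x_n)`
such that, for all sequences `x_n^j → x_n` in `X`, some set `{x_n^j : j ≥ k_n}` has compact
closure. -/
def PropertyA {X : Type u} [TopologicalSpace X] (E : Set X) : Prop :=
  ∀ (x : ℕ → X) (x₀ : X), Function.Injective x → (∀ m, x m ∈ E) → Tendsto x atTop (𝓝 x₀) →
    ∃ φ : ℕ → ℕ, StrictMono φ ∧
      ∀ z : ℕ → ℕ → X, (∀ n, Tendsto (z n) atTop (𝓝 (x (φ n)))) →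
        ∃ k : ℕ → ℕ, IsCompact (closure {p : X | ∃ n j, k n ≤ j ∧ p = z n j})

/-- Property (b): every convergent sequence of distinct points of `X`, with limit `x₀`, has a
subsequence `(x_n)` and sequences `x_n^j → x_n` in `E` such that every diagonal sequence
`n ↦ x_n^{j(n)}` converges to `x₀`. -/
def PropertyB {X : Type u} [TopologicalSpace X] (E : Set X) : Prop :=
  ∀ (x : ℕ → X) (x₀ : X), Function.Injective x → Tendsto x atTop (𝓝 x₀) →
    ∃ φ : ℕ → ℕ, StrictMono φ ∧
      ∃ z : ℕ → ℕ → X, (∀ n j, z n j ∈ E) ∧ (∀ n, Tendsto (z n) atTop (𝓝 (x (φ n)))) ∧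
        ∀ j : ℕ → ℕ, Tendsto (fun n => z n (j n)) atTop (𝓝 x₀)

/-! ### Standard spaces and the Fell hyperspace -/

/-! Two Baire category arguments and the compactness of the Fell hyperspace carry the proof.

From an irreducible quotient map `q` to (a) and (b): the set `E` is the image of the singleton
fibres, which are dense by Baire (`dense_singletonFibres`). A sequence converging to `q y` with `y`
a singleton fibre eventually lies in the image of any neighbourhood of `y`, which gives compact type
and (a); density alone gives (b).

From `E` to the restriction of `q_*`: exhaust `Y` by compact sets `K n`; every compact subset of `X`
lies in some `q '' K n`. By (a), one `q '' K r` witnesses compact type for all points of `E ∩ q '' K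
p`. Let `A` be the closure of the points of `E` whose type is witnessed by `q '' K p`. By (b),
sequences converging to a point of `A` of this type eventually stay in `A`. A generic point `a` of
the compact set `A` has this type and lies on no relative boundary of `q '' C`, for `C` in a
countable family of compact neighbourhoods. Fibres over points tending to `a` then cannot lose any
part of `q ⁻¹' {a}` in the limit, so `a` has a singleton fibre in `Y_*`
(`closure_inter_typePoints_subset`). Hence compact pieces of `V` cover each `E ∩ q '' K p`, which
yields surjectivity and the quotient property. Irreducibility is automatic, since a closed set
mapped onto `X` contains all singleton fibres.

Finally, `V` is itself standard, being closed in a locally closed subspace of a compact metrizable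
hyperspace. -/

theorem IsStandardSpace.secondCountable {Y : Type v} [TopologicalSpace Y]
    (hY : IsStandardSpace Y) : SecondCountableTopology Y := by
  have := hY.separable
  have := hY.metrizable
  let := TopologicalSpace.metrizableSpaceMetric Y
  exact UniformSpace.secondCountable_of_separable Y

/-- A locally compact, second countable, regular space has a countable family of compact sets
that contains a neighbourhood base of every point. -/
theorem exists_countable_compact_nhds (Y : Type v) [TopologicalSpace Y] [LocallyCompactSpace Y]
    [SecondCountableTopology Y] [RegularSpace Y] :
    ∃ 𝒞 : Set (Set Y), 𝒞.Countable ∧ (∀ C ∈ 𝒞, IsCompact C) ∧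
      ∀ (y : Y) (O : Set Y), IsOpen O → y ∈ O → ∃ C ∈ 𝒞, y ∈ interior C ∧ C ⊆ O := by
  refine ⟨{C | C ∈ closure '' TopologicalSpace.countableBasis Y ∧ IsCompact C},
    ((TopologicalSpace.countable_countableBasis Y).image _).mono fun C hC => hC.1,
    fun C hC => hC.2, fun y O hO hy => ?_⟩
  obtain ⟨N, hN, hyN, hNO⟩ := exists_compact_subset hO hy
  obtain ⟨B, hB, hyB, hBN⟩ := (TopologicalSpace.isBasis_countableBasis Y).exists_closure_subset
    (isOpen_interior.mem_nhds hyN)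
  refine ⟨closure B, ⟨⟨B, hB, rfl⟩, hN.closure_of_subset ?_⟩, ?_, ?_⟩
  · exact (subset_closure.trans hBN).trans interior_subset
  · exact interior_maximal subset_closure (TopologicalSpace.isOpen_of_mem_countableBasis hB) hyB
  · exact (hBN.trans interior_subset).trans hNO

/-! ### Compactness and metrizability of the Fell topology. -/

namespace FellCloseds

variable {Y : Type v} [TopologicalSpace Y]

theorem isClosed_toSet (F : FellCloseds Y) : IsClosed F.toSet :=
  TopologicalSpace.Closeds.isClosed F

theorem ext_toSet {F G : FellCloseds Y} (h : F.toSet = G.toSet) : F = G :=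
  TopologicalSpace.Closeds.ext h

/-- A closed set as a point of the Fell hyperspace. -/
def ofClosed (A : Set Y) (hA : IsClosed A) : FellCloseds Y :=
  (⟨A, hA⟩ : TopologicalSpace.Closeds Y)

theorem isOpen_hit {U : Set Y} (hU : IsOpen U) :
    IsOpen {F : FellCloseds Y | (F.toSet ∩ U).Nonempty} :=
  TopologicalSpace.isOpen_generateFrom_of_mem (Or.inr ⟨U, hU, rfl⟩)

theorem isOpen_miss {K : Set Y} (hK : IsCompact K) :
    IsOpen {F : FellCloseds Y | F.toSet ∩ K = ∅} :=
  TopologicalSpace.isOpen_generateFrom_of_mem (Or.inl ⟨K, hK, rfl⟩)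

theorem isClosed_hit {K : Set Y} (hK : IsCompact K) :
    IsClosed {F : FellCloseds Y | (F.toSet ∩ K).Nonempty} := by
  have h : {F : FellCloseds Y | (F.toSet ∩ K).Nonempty} =
      {F : FellCloseds Y | F.toSet ∩ K = ∅}ᶜ := by
    ext F
    simp [nonempty_iff_ne_empty]
  rw [h]
  exact (isOpen_miss hK).isClosed_compl

instance : CompactSpace (FellCloseds Y) := by
  refine compactSpace_generateFrom rfl fun P hP hcov => ?_
  -- Alexander's subbasis lemma. The closed set `Wᶜ` avoids every `U` used in the cover, so only a
  -- set of the "miss `K`" kind can contain it. Then `K ⊆ W`, and finitely many of the `U` cover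
  -- `K`.
  set W : Set Y := ⋃₀ {U | IsOpen U ∧ {F : FellCloseds Y | (F.toSet ∩ U).Nonempty} ∈ P} with hW
  have hWo : IsOpen W := isOpen_sUnion fun U hU => hU.1
  obtain ⟨S, hSP, hS⟩ : ofClosed Wᶜ hWo.isClosed_compl ∈ ⋃₀ P := hcov ▸ mem_univ _
  rcases hP hSP with ⟨K, hK, rfl⟩ | ⟨U, hU, rfl⟩
  · have hKW : K ⊆ W := by
      intro y hy
      by_contra hyW
      exact (eq_empty_iff_forall_notMem.1 hS) y ⟨hyW, hy⟩
    obtain ⟨T, hTs, hTf, hKT⟩ := hK.elim_finite_subcover_image (c := fun U : Set Y => U)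
      (fun U hU => hU.1) (hKW.trans_eq (hW.trans sUnion_eq_biUnion))
    refine ⟨insert {F | F.toSet ∩ K = ∅}
      ((fun U => {F : FellCloseds Y | (F.toSet ∩ U).Nonempty}) '' T), ?_,
      (hTf.image _).insert _, ?_⟩
    · rintro _ (rfl | ⟨U, hU, rfl⟩)
      · exact hSP
      · exact (hTs hU).2
    · refine eq_univ_of_forall fun F => ?_
      rcases (F.toSet ∩ K).eq_empty_or_nonempty with h | ⟨y, hyF, hyK⟩
      · exact ⟨_, Or.inl rfl, h⟩
      · obtain ⟨U, hU, hyU⟩ := mem_iUnion₂.1 (hKT hyK)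
        exact ⟨_, Or.inr ⟨U, hU, rfl⟩, ⟨y, hyF, hyU⟩⟩
  · obtain ⟨y, hyW, hyU⟩ := hS
    exact absurd ⟨U, ⟨hU, hSP⟩, hyU⟩ hyW

/-- A countable subfamily of the Fell subbasis that separates points. -/
theorem exists_countable_separating [LocallyCompactSpace Y] [SecondCountableTopology Y]
    [RegularSpace Y] :
    ∃ c : Set (Set (FellCloseds Y)), c.Countable ∧ (∀ S ∈ c, IsOpen S) ∧
      @T2Space _ (TopologicalSpace.generateFrom c) := by
  obtain ⟨𝒞, h𝒞, hcomp, hbase⟩ := exists_countable_compact_nhds Y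
  set hit : Set Y → Set (FellCloseds Y) := fun C => {F | (F.toSet ∩ interior C).Nonempty}
  set miss : Set Y → Set (FellCloseds Y) := fun C => {F | F.toSet ∩ C = ∅}
  refine ⟨hit '' 𝒞 ∪ miss '' 𝒞, (h𝒞.image _).union (h𝒞.image _), ?_, ?_⟩
  · rintro _ (⟨C, hC, rfl⟩ | ⟨C, hC, rfl⟩)
    · exact isOpen_hit isOpen_interior
    · exact isOpen_miss (hcomp C hC)
  · let := TopologicalSpace.generateFrom (hit '' 𝒞 ∪ miss '' 𝒞)
    have key : ∀ F G : FellCloseds Y, ¬ F.toSet ⊆ G.toSet →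
        ∃ U V : Set (FellCloseds Y), IsOpen U ∧ IsOpen V ∧ F ∈ U ∧ G ∈ V ∧ Disjoint U V := by
      intro F G h
      obtain ⟨y, hyF, hyG⟩ := not_subset.1 h
      obtain ⟨C, hC, hyC, hCG⟩ := hbase y G.toSetᶜ G.isClosed_toSet.isOpen_compl hyG
      refine ⟨hit C, miss C,
        TopologicalSpace.isOpen_generateFrom_of_mem (Or.inl ⟨C, hC, rfl⟩),
        TopologicalSpace.isOpen_generateFrom_of_mem (Or.inr ⟨C, hC, rfl⟩), ⟨y, hyF, hyC⟩, ?_, ?_⟩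
      · exact eq_empty_of_forall_notMem fun z hz => hCG hz.2 hz.1
      · rw [Set.disjoint_left]
        rintro H ⟨z, hzH, hzC⟩ hH
        exact (eq_empty_iff_forall_notMem.1 hH) z ⟨hzH, interior_subset hzC⟩
    refine ⟨fun F G hne => ?_⟩
    by_cases h : F.toSet ⊆ G.toSet
    · have h' : ¬ G.toSet ⊆ F.toSet := fun h' => hne (ext_toSet (h.antisymm h'))
      obtain ⟨U, V, hU, hV, hG, hF, hd⟩ := key G F h'
      exact ⟨V, U, hV, hU, hF, hG, hd.symm⟩
    · exact key F G h

/-- A compact topology finer than a Hausdorff one coincides with it, so the countable separating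
subfamily already generates the Fell topology. -/
theorem t2_and_secondCountable [LocallyCompactSpace Y] [SecondCountableTopology Y]
    [RegularSpace Y] : T2Space (FellCloseds Y) ∧ SecondCountableTopology (FellCloseds Y) := by
  obtain ⟨c, hc, hopen, hT2⟩ := exists_countable_separating (Y := Y)
  have hle : instTopologicalSpace Y ≤ TopologicalSpace.generateFrom c := le_generateFrom hopen
  have heq : instTopologicalSpace Y = TopologicalSpace.generateFrom c := by
    refine le_antisymm hle fun U hU => ?_
    have hcont : @Continuous _ _ (instTopologicalSpace Y) (TopologicalSpace.generateFrom c) id :=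
      continuous_id_iff_le.2 hle
    have hcl := @Continuous.isClosedMap _ _ (instTopologicalSpace Y)
      (TopologicalSpace.generateFrom c) _ hT2 id hcont Uᶜ hU.isClosed_compl
    rw [image_id] at hcl
    exact (@isClosed_compl_iff _ (TopologicalSpace.generateFrom c) U).1 hcl
  refine ⟨?_, ⟨c, hc, heq⟩⟩
  rw [← heq] at hT2
  exact hT2

end FellCloseds

/-- Being nonempty is the open condition of hitting `univ`, so `Y_*` is locally closed in a compact,
second countable Hausdorff space. -/
theorem isStandardSpace_of_isClosed_fellStar {X : Type u} {Y : Type v} [TopologicalSpace Y]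
    {q : Y → X} (hY : IsStandardSpace Y) {V : Set (fellStar q)} (hV : IsClosed V) :
    IsStandardSpace V := by
  have := hY.locallyCompact
  have := hY.metrizable
  have := hY.secondCountable
  obtain ⟨_, _⟩ := FellCloseds.t2_and_secondCountable (Y := Y)
  have hloc : IsLocallyClosed (fellStar q) := by
    have h : fellStar q =
        closure (fibreSet q) ∩ {F : FellCloseds Y | (F.toSet ∩ univ).Nonempty} := by
      ext F
      simp [fellStar]
    rw [h]
    exact isClosed_closure.isLocallyClosed.inter
      (FellCloseds.isOpen_hit isOpen_univ).isLocallyClosed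
  have := hloc.locallyCompactSpace
  exact ⟨hV.isClosedEmbedding_subtypeVal.locallyCompactSpace, inferInstance,
    TopologicalSpace.metrizableSpace_of_t3_secondCountable _⟩

/-! ### The space `Y_*` and the map `q_*`. -/

section FellStar

variable {X : Type u} {Y : Type v} [TopologicalSpace X] [TopologicalSpace Y] {q : Y → X}

theorem continuous_qStar [T2Space X] (hq : Continuous q) : Continuous (qStar q) := by
  refine continuous_def.2 fun O hO => ?_
  have h : qStar q ⁻¹' O = Subtype.val ⁻¹' {G : FellCloseds Y | (G.toSet ∩ q ⁻¹' O).Nonempty} := by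
    ext F
    constructor
    · intro hF
      exact ⟨_, F.2.2.some_mem, hF⟩
    · rintro ⟨y, hyF, hyO⟩
      rw [mem_preimage, qStar_eq hq F hyF]
      exact hyO
  rw [h]
  exact (FellCloseds.isOpen_hit (hO.preimage hq)).preimage continuous_subtype_val

/-- The fibre through `y` as a point of `Y_*`. -/
def fibreStar [T2Space X] (hq : Continuous q) (y : Y) : fellStar q :=
  ⟨FellCloseds.ofClosed (q ⁻¹' {q y}) (isClosed_singleton.preimage hq),
    subset_closure ⟨y, rfl⟩, ⟨y, rfl⟩⟩

theorem toSet_fibreStar [T2Space X] (hq : Continuous q) (y : Y) :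
    (fibreStar hq y).1.toSet = q ⁻¹' {q y} := rfl

theorem qStar_fibreStar [T2Space X] (hq : Continuous q) (y : Y) :
    qStar q (fibreStar hq y) = q y :=
  qStar_eq hq _ (toSet_fibreStar hq y ▸ rfl)

/-- Every point of `Y_*` is the limit of a sequence of fibres. -/
theorem exists_seq_fibres_tendsto (hY : IsStandardSpace Y) (hq : Continuous q) [T2Space X]
    (F : fellStar q) :
    ∃ y : ℕ → Y, Tendsto (fun n => (fibreStar hq (y n)).1) atTop (𝓝 F.1) ∧
      Tendsto (fun n => q (y n)) atTop (𝓝 (qStar q F)) := by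
  have := hY.locallyCompact
  have := hY.metrizable
  have := hY.secondCountable
  obtain ⟨_, _⟩ := FellCloseds.t2_and_secondCountable (Y := Y)
  obtain ⟨G, hG, hlim⟩ := mem_closure_iff_seq_limit.1 F.2.1
  choose y hy using hG
  have hGy : ∀ n, G n = (fibreStar hq (y n)).1 := fun n => FellCloseds.ext_toSet (hy n)
  have hlim' : Tendsto (fun n => fibreStar hq (y n)) atTop (𝓝 F) := by
    rw [tendsto_subtype_rng]
    exact hlim.congr hGy
  refine ⟨y, hlim.congr hGy, ?_⟩
  exact (((continuous_qStar hq).tendsto F).comp hlim').congr fun n => qStar_fibreStar hq (y n)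

end FellStar

/-! ### Quotients of standard spaces -/

section Sequences

variable {X : Type u} [TopologicalSpace X]

/-- A sequence that converges to `a` and frequently satisfies `P`, where `P a` fails, has an
injective subsequence all of whose terms satisfy `P`. -/
theorem exists_injective_subseq [T1Space X] {x : ℕ → X} {a : X} (hx : Tendsto x atTop (𝓝 a))
    {P : X → Prop} (hP : ∃ᶠ n in atTop, P (x n)) (ha : ¬ P a) :
    ∃ φ : ℕ → ℕ, StrictMono φ ∧ Function.Injective (x ∘ φ) ∧ ∀ n, P (x (φ n)) := by
  obtain ⟨φ, h1, h2⟩ := exists_seq_of_forall_finset_exists (fun n => P (x n))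
    (fun i j => i < j ∧ x i ≠ x j) (by
      intro s hs
      have hev : ∀ᶠ n in atTop, ∀ i ∈ s, i < n ∧ x i ≠ x n := by
        refine (eventually_all_finset s).2 fun i hi => (eventually_gt_atTop i).and ?_
        have hne : a ≠ x i := fun h => ha (h ▸ hs i hi)
        filter_upwards [hx.eventually (isOpen_ne.mem_nhds hne)] with n hn using Ne.symm hn
      exact (hP.and_eventually hev).exists)
  refine ⟨φ, fun m n hmn => (h2 m n hmn).1, fun m n hmn => ?_, h1⟩
  rcases lt_trichotomy m n with h | h | h
  · exact absurd hmn (h2 m n h).2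
  · exact h
  · exact absurd hmn.symm (h2 n m h).2

end Sequences

section Quotients

variable {X : Type u} {Y : Type v} [TopologicalSpace X] [TopologicalSpace Y]
  {q : Y → X}

/-- Closedness can be tested on `q ⁻¹' A`, hence locally in `Y`, and each point of `Y` has some `K
n` as a neighbourhood. -/
theorem isClosed_of_forall_inter_image (hq : IsQuotientMap q) (K : CompactExhaustion Y) {A : Set X}
    (hA : ∀ n, IsClosed (A ∩ q '' K n)) : IsClosed A := by
  rw [← (isQuotientMap_iff_isClosed.1 hq).2 A |>.symm]
  refine isClosed_of_closure_subset fun y hy => ?_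
  obtain ⟨n, hn⟩ := K.exists_mem_nhds y
  have h1 : y ∈ closure (q ⁻¹' (A ∩ q '' K n)) := by
    refine mem_closure_iff_nhds.2 fun t ht => ?_
    obtain ⟨z, ⟨hzt, hzK⟩, hzA⟩ := mem_closure_iff_nhds.1 hy _ (inter_mem ht hn)
    exact ⟨z, hzt, hzA, mem_image_of_mem q hzK⟩
  rw [((hA n).preimage hq.continuous).closure_eq] at h1
  exact h1.1

/-- Otherwise pick `x n ∈ L` outside `q '' K n`. Each `q '' K m` contains only finitely many terms,
so the tails are closed; they are nested nonempty compact sets with empty intersection. -/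
theorem exists_subset_image_of_isCompact [T2Space X] (hq : IsQuotientMap q)
    (K : CompactExhaustion Y)
    {L : Set X} (hL : IsCompact L) : ∃ n, L ⊆ q '' K n := by
  by_contra! h
  choose x hxL hxK using fun n => not_subset.1 (h n)
  have hlt : ∀ {i m}, x i ∈ q '' K m → i < m := by
    intro i m hi
    by_contra! hmi
    exact hxK i (image_mono (K.subset hmi) hi)
  have hcl : ∀ m, IsClosed (x '' Ici m) := by
    intro m
    refine isClosed_of_forall_inter_image hq K fun n => Set.Finite.isClosed ?_
    refine ((finite_lt_nat n).image x).subset ?_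
    rintro _ ⟨⟨i, -, rfl⟩, hi⟩
    exact ⟨i, hlt hi, rfl⟩
  obtain ⟨z, hz⟩ := IsCompact.nonempty_iInter_of_sequence_nonempty_isCompact_isClosed
    (fun m => x '' Ici m) (fun m => image_mono (Ici_subset_Ici.2 m.le_succ))
    (fun m => ⟨x m, m, self_mem_Ici, rfl⟩)
    (hL.of_isClosed_subset (hcl 0) (by rintro _ ⟨i, -, rfl⟩; exact hxL i)) hcl
  rw [mem_iInter] at hz
  obtain ⟨y, rfl⟩ := hq.surjective z
  obtain ⟨m, hm⟩ := K.exists_mem y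
  obtain ⟨i, hi, hiy⟩ := hz m
  have hi' := hlt (m := m) (i := i) (hiy ▸ mem_image_of_mem q hm)
  exact absurd hi (not_le.2 hi')

theorem exists_forall_mem_image_of_tendsto [T2Space X] (hq : IsQuotientMap q)
    (K : CompactExhaustion Y)
    {x : ℕ → X} {a : X} (hx : Tendsto x atTop (𝓝 a)) :
    ∃ n, a ∈ q '' K n ∧ ∀ i, x i ∈ q '' K n := by
  obtain ⟨n, hn⟩ := exists_subset_image_of_isCompact hq K hx.isCompact_insert_range
  exact ⟨n, hn (mem_insert _ _), fun i => hn (mem_insert_of_mem _ (mem_range_self i))⟩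

/-- Sequences inside the image of a compact set have subsequences with convergent lifts. -/
theorem exists_subseq_lift_of_mem_image {Z : Type*} {f : Y → Z}
    [FirstCountableTopology Y] {C : Set Y} (hC : IsCompact C)
    {x : ℕ → Z} (hx : ∀ n, x n ∈ f '' C) :
    ∃ φ : ℕ → ℕ, StrictMono φ ∧ ∃ (y : ℕ → Y) (b : Y), (∀ n, f (y n) = x (φ n)) ∧
      Tendsto y atTop (𝓝 b) := by
  choose y hyC hy using hx
  obtain ⟨b, -, φ, hφ, hlim⟩ := hC.tendsto_subseq hyC
  exact ⟨φ, hφ, y ∘ φ, b, fun n => hy _, hlim⟩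

theorem exists_subseq_lift [T2Space X] [FirstCountableTopology Y] (hq : IsQuotientMap q)
    (K : CompactExhaustion Y) {x : ℕ → X} {a : X} (hx : Tendsto x atTop (𝓝 a)) :
    ∃ φ : ℕ → ℕ, StrictMono φ ∧ ∃ (y : ℕ → Y) (b : Y), (∀ n, q (y n) = x (φ n)) ∧ q b = a ∧
      Tendsto y atTop (𝓝 b) := by
  obtain ⟨n, -, hn⟩ := exists_forall_mem_image_of_tendsto hq K hx
  obtain ⟨φ, hφ, y, b, hy, hlim⟩ := exists_subseq_lift_of_mem_image (K.isCompact n) hn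
  refine ⟨φ, hφ, y, b, hy, ?_, hlim⟩
  have h1 : Tendsto (q ∘ y) atTop (𝓝 (q b)) := (hq.continuous.tendsto b).comp hlim
  refine tendsto_nhds_unique h1 ((hx.comp hφ.tendsto_atTop).congr fun n => (hy n).symm)

/-- Images of compact sets in `X` are Fréchet–Urysohn. -/
theorem exists_seq_tendsto_of_mem_closure_image [T2Space X] [FrechetUrysohnSpace Y] [T2Space Y]
    (hq : Continuous q) {C : Set Y} (hC : IsCompact C) {S : Set X} (hS : S ⊆ q '' C) {a : X}
    (ha : a ∈ closure S) : ∃ x : ℕ → X, (∀ n, x n ∈ S) ∧ Tendsto x atTop (𝓝 a) := by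
  have hcomp : IsCompact (closure (q ⁻¹' S ∩ C)) := hC.closure_of_subset inter_subset_right
  have hsub : S ⊆ q '' closure (q ⁻¹' S ∩ C) := by
    intro s hs
    obtain ⟨y, hy, rfl⟩ := hS hs
    exact ⟨y, subset_closure ⟨hs, hy⟩, rfl⟩
  obtain ⟨y, hy, rfl⟩ := closure_minimal hsub (hcomp.image hq).isClosed ha
  obtain ⟨z, hz, hlim⟩ := mem_closure_iff_seq_limit.1 hy
  exact ⟨q ∘ z, fun n => (hz n).1, (hq.tendsto y).comp hlim⟩

/-! ### Irreducible quotient maps -/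

/-- For disjoint compact `C`, `D`, the points of `C` sharing a fibre with a point of `D` form a
closed set. Its interior can be removed without losing a value of `q`, so irreducibility makes it
empty. A point outside all these sets, for countably many pairs, has a singleton fibre. -/
theorem dense_singletonFibres [T2Space X] [LocallyCompactSpace Y]
    [SecondCountableTopology Y] [T2Space Y]
    (hq : Continuous q) (hirr : IsIrreducibleMap q) : Dense (singletonFibres q) := by
  obtain ⟨𝒞, h𝒞, hcomp, hbase⟩ := exists_countable_compact_nhds Y
  set 𝒟 : Set (Set Y × Set Y) := {p | p ∈ 𝒞 ×ˢ 𝒞 ∧ Disjoint p.1 p.2}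
  have hcl : ∀ p ∈ 𝒟, IsClosed (p.1 ∩ q ⁻¹' (q '' p.2)) := fun p hp =>
    (hcomp _ hp.1.1).isClosed.inter (((hcomp _ hp.1.2).image hq).isClosed.preimage hq)
  have hdense : Dense (⋂ p ∈ 𝒟, (p.1 ∩ q ⁻¹' (q '' p.2))ᶜ) := by
    refine dense_biInter_of_isOpen (fun p hp => (hcl p hp).isOpen_compl)
      ((h𝒞.prod h𝒞).mono fun p hp => hp.1) fun p hp => ?_
    rw [← interior_eq_empty_iff_dense_compl]
    set U := interior (p.1 ∩ q ⁻¹' (q '' p.2)) with hU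
    have huniv : Uᶜ = univ := by
      refine hirr.2 _ isOpen_interior.isClosed_compl (eq_univ_of_forall fun x => ?_)
      obtain ⟨y, rfl⟩ := hirr.1 x
      by_cases hy : y ∈ U
      · obtain ⟨-, z, hz, hzy⟩ := interior_subset hy
        exact ⟨z, fun hzU => Set.disjoint_left.1 hp.2 (interior_subset hzU).1 hz, hzy⟩
      · exact ⟨y, hy, rfl⟩
    simpa using huniv
  refine hdense.mono fun y hy => ?_
  refine Subset.antisymm (fun z hz => ?_) (by rintro _ rfl; rfl)
  by_contra hne
  obtain ⟨O, W, hO, hW, hyO, hzW, hd⟩ := t2_separation (Ne.symm hne)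
  obtain ⟨C, hC, hyC, hCO⟩ := hbase y O hO hyO
  obtain ⟨D, hD, hzD, hDW⟩ := hbase z W hW hzW
  exact mem_iInter₂.1 hy (C, D) ⟨⟨hC, hD⟩, hd.mono hCO hDW⟩
    ⟨interior_subset hyC, z, interior_subset hzD, hz⟩

/-- A subsequence avoiding `q '' N` would have a further subsequence with a convergent lift, whose
limit lies in the fibre `{y}`. -/
theorem eventually_mem_image_of_mem_singletonFibres [T2Space X] [FirstCountableTopology Y]
    (hq : IsQuotientMap q) (K : CompactExhaustion Y) {y : Y} (hy : y ∈ singletonFibres q)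
    {N : Set Y} (hN : N ∈ 𝓝 y) {x : ℕ → X} (hx : Tendsto x atTop (𝓝 (q y))) :
    ∀ᶠ n in atTop, x n ∈ q '' N := by
  by_contra h
  obtain ⟨φ, hφ, hφN⟩ := extraction_of_frequently_atTop (not_eventually.1 h)
  obtain ⟨ψ, -, z, b, hz, hb, hlim⟩ := exists_subseq_lift hq K (hx.comp hφ.tendsto_atTop)
  have hby : b = y := by
    have : b ∈ q ⁻¹' {q y} := hb
    rwa [show q ⁻¹' {q y} = {y} from hy] at this
  subst hby
  obtain ⟨n, hn⟩ := (hlim.eventually hN).exists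
  exact hφN (ψ n) ⟨z n, hn, hz n⟩

theorem sequentiallyDense_image [FrechetUrysohnSpace Y] (hq : Continuous q)
    (hsurj : Function.Surjective q) {S : Set Y} (hS : Dense S) : SequentiallyDense (q '' S) := by
  intro x
  obtain ⟨y, rfl⟩ := hsurj x
  obtain ⟨s, hs, hlim⟩ := mem_closure_iff_seq_limit.1 (hS y)
  exact ⟨q ∘ s, fun n => mem_image_of_mem q (hs n), (hq.tendsto y).comp hlim⟩

theorem isCompactTypePoint_of_mem_singletonFibres [T2Space X] [FirstCountableTopology Y]
    [LocallyCompactSpace Y] (hq : IsQuotientMap q) (K : CompactExhaustion Y) {y : Y}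
    (hy : y ∈ singletonFibres q) : IsCompactTypePoint (q y) := by
  obtain ⟨N, hN, hyN⟩ := exists_compact_mem_nhds y
  exact ⟨q '' N, hN.image hq.continuous, fun s hs =>
    eventually_mem_image_of_mem_singletonFibres hq K hy hyN hs⟩

theorem propertyA_image_singletonFibres [T2Space X] [FirstCountableTopology Y]
    [LocallyCompactSpace Y]
    (hq : IsQuotientMap q) (K : CompactExhaustion Y) : PropertyA (q '' singletonFibres q) := by
  intro x x₀ _ hxE hx
  obtain ⟨φ, hφ, y, b, hy, -, hlim⟩ := exists_subseq_lift hq K hx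
  refine ⟨φ, hφ, fun z hz => ?_⟩
  have hyS : ∀ n, y n ∈ singletonFibres q := by
    intro n
    obtain ⟨w, hw, hwx⟩ := hxE (φ n)
    have hyw : y n ∈ q ⁻¹' {q w} := (hy n).trans hwx.symm
    rw [show q ⁻¹' {q w} = {w} from hw] at hyw
    exact hyw ▸ hw
  obtain ⟨N₀, hN₀, hbN₀⟩ := exists_compact_mem_nhds b
  -- All but finitely many `y n` lie in the interior of `N₀`; only the remaining ones need compact
  -- neighbourhoods of their own, so the union stays compact.
  have hN : ∀ n, ∃ N : Set Y, IsCompact N ∧ N ∈ 𝓝 (y n) ∧ (y n ∈ interior N₀ → N ⊆ N₀) := by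
    intro n
    by_cases hn : y n ∈ interior N₀
    · exact ⟨N₀, hN₀, mem_interior_iff_mem_nhds.1 hn, fun _ => Subset.rfl⟩
    · obtain ⟨N, hN, hyN⟩ := exists_compact_mem_nhds (y n)
      exact ⟨N, hN, hyN, fun h => absurd h hn⟩
  choose N hNc hNy hNsub using hN
  obtain ⟨n₀, hn₀⟩ := eventually_atTop.1
    (hlim.eventually (isOpen_interior.mem_nhds (mem_interior_iff_mem_nhds.2 hbN₀)))
  have hev : ∀ n, ∃ k, ∀ j, k ≤ j → z n j ∈ q '' N n := fun n => eventually_atTop.1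
    (eventually_mem_image_of_mem_singletonFibres hq K (hyS n) (hNy n) ((hy n).symm ▸ hz n))
  choose k hk using hev
  refine ⟨k, IsCompact.closure_of_subset
    ((hN₀.union ((finite_lt_nat n₀).isCompact_biUnion fun n _ => hNc n)).image hq.continuous) ?_⟩
  rintro _ ⟨n, j, hj, rfl⟩
  refine image_mono ?_ (hk n j hj)
  by_cases hn : n < n₀
  · exact fun w hw => Or.inr (mem_biUnion (show n ∈ {i | i < n₀} from hn) hw)
  · exact (hNsub n (hn₀ n (not_lt.1 hn))).trans subset_union_left

theorem propertyB_image_of_dense [T2Space X] [TopologicalSpace.MetrizableSpace Y]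
    (hq : IsQuotientMap q)
    (K : CompactExhaustion Y) {S : Set Y} (hS : Dense S) : PropertyB (q '' S) := by
  intro x x₀ _ hx
  let := TopologicalSpace.metrizableSpaceMetric Y
  obtain ⟨φ, hφ, y, b, hy, hb, hlim⟩ := exists_subseq_lift hq K hx
  -- The bound tends to zero in `j` for fixed `n`, and in `n` uniformly in `j`; the latter handles
  -- arbitrary diagonals.
  have hex : ∀ n j : ℕ, ∃ w ∈ S, dist (y n) w < 1 / ((n + j : ℕ) + 1 : ℝ) := fun n j =>
    hS.exists_dist_lt _ Nat.one_div_pos_of_nat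
  choose w hwS hw using hex
  have hsq : Tendsto (fun n : ℕ => 1 / ((n : ℝ) + 1)) atTop (𝓝 0) :=
    tendsto_one_div_add_atTop_nhds_zero_nat
  refine ⟨φ, hφ, fun n j => q (w n j), fun n j => mem_image_of_mem q (hwS n j), fun n => ?_,
    fun j => ?_⟩
  · rw [← hy n]
    refine (hq.continuous.tendsto _).comp (tendsto_iff_dist_tendsto_zero.2 ?_)
    refine squeeze_zero (fun _ => dist_nonneg) (fun j => ?_) hsq
    rw [dist_comm]
    exact (hw n j).le.trans (Nat.one_div_le_one_div (Nat.le_add_left j n))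
  · rw [← hb]
    refine (hq.continuous.tendsto _).comp (hlim.congr_dist ?_)
    refine squeeze_zero (fun _ => dist_nonneg) (fun n => ?_) hsq
    exact (hw n (j n)).le.trans (Nat.one_div_le_one_div (Nat.le_add_right n (j n)))

end Quotients

/-! ### Points of bounded type and singleton fibres of `q_*` -/

section SingletonClosure

variable {X : Type u} {Y : Type v} [TopologicalSpace X] [TopologicalSpace Y]
  {q : Y → X}

/-- The points `a` such that no sequence in `X` outside of `q '' K p` converges to `a`, so that
`q '' K p` witnesses that `a` is of compact type
(see `eventually_mem_image_of_mem_typePoints`). -/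
def typePoints (q : Y → X) (K : CompactExhaustion Y) (p : ℕ) : Set X :=
  {a | ∀ M, a ∉ closure (q '' K M \ q '' K p)}

theorem typePoints_mono (q : Y → X) (K : CompactExhaustion Y) {p r : ℕ} (hpr : p ≤ r) :
    typePoints q K p ⊆ typePoints q K r := fun _ ha M h =>
  ha M (closure_mono (sdiff_subset_sdiff_right (image_mono (K.subset hpr))) h)

section

variable [T2Space X] (K : CompactExhaustion Y)

theorem eventually_mem_image_of_mem_typePoints (hq : IsQuotientMap q) {p : ℕ} {a : X}
    (ha : a ∈ typePoints q K p) {x : ℕ → X} (hx : Tendsto x atTop (𝓝 a)) :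
    ∀ᶠ n in atTop, x n ∈ q '' K p := by
  obtain ⟨M, -, hM⟩ := exists_forall_mem_image_of_tendsto hq K hx
  by_contra h
  refine ha M (mem_closure_of_frequently_of_tendsto ?_ hx)
  exact (not_eventually.1 h).mono fun n hn => ⟨hM n, hn⟩

theorem typePoints_subset_image (hq : IsQuotientMap q) (p : ℕ) :
    typePoints q K p ⊆ q '' K p := fun _ ha =>
  (eventually_mem_image_of_mem_typePoints K hq ha tendsto_const_nhds).exists.choose_spec

theorem IsCompactTypePoint.exists_mem_typePoints [FrechetUrysohnSpace Y] [T2Space Y]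
    (hq : IsQuotientMap q) {a : X} (ha : IsCompactTypePoint a) : ∃ p, a ∈ typePoints q K p := by
  obtain ⟨L, hL, hLa⟩ := ha
  obtain ⟨p, hp⟩ := exists_subset_image_of_isCompact hq K hL
  refine ⟨p, fun M hM => ?_⟩
  obtain ⟨s, hs, hlim⟩ := exists_seq_tendsto_of_mem_closure_image hq.continuous
    (K.isCompact M) sdiff_subset hM
  obtain ⟨n, hn⟩ := (hLa s hlim).exists
  exact (hs n).2 (hp hn)

variable {E : Set X}

/-- Property (a) bounds the type of the points of `E` inside a fixed compact set. -/
theorem PropertyA.exists_inter_image_subset_typePoints [FirstCountableTopology Y] [T2Space Y]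
    (hq : IsQuotientMap q) (hE : ∀ x ∈ E, IsCompactTypePoint x) (hA : PropertyA E) (p : ℕ) :
    ∃ r, E ∩ q '' K p ⊆ typePoints q K r := by
  by_contra! h
  choose e he het using fun r => not_subset.1 (h r)
  have hex : ∀ r, ∃ t, e r ∈ typePoints q K t := fun r =>
    (hE _ (he r).1).exists_mem_typePoints K hq
  choose t ht using hex
  -- Distinct terms: `e i` has type `t i`, whereas `e j` does not have type `j`, so `e j ≠ e i` once
  -- `j ≥ t i`.
  obtain ⟨f, -, hf⟩ := exists_seq_of_forall_finset_exists (fun _ : ℕ => True)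
    (fun i j => i < j ∧ e i ≠ e j) (by
      intro s _
      obtain ⟨j, hj⟩ := (s.finite_toSet.image fun i => max (i + 1) (t i)).bddAbove
      refine ⟨j, trivial, fun i hi => ?_⟩
      have hij : max (i + 1) (t i) ≤ j := hj ⟨i, hi, rfl⟩
      refine ⟨(le_max_left _ _).trans hij, fun heq => het j ?_⟩
      exact heq ▸ typePoints_mono q K ((le_max_right _ _).trans hij) (ht i))
  have hfm : StrictMono f := fun m n hmn => (hf m n hmn).1
  have hinj : Function.Injective (e ∘ f) := by
    intro m n hmn
    rcases lt_trichotomy m n with h | h | h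
    · exact absurd hmn (hf m n h).2
    · exact h
    · exact absurd hmn.symm (hf n m h).2
  obtain ⟨ψ, hψ, y, b, hy, hlim⟩ := exists_subseq_lift_of_mem_image (f := q) (K.isCompact p)
    (x := e ∘ f) (fun n => (he (f n)).2)
  obtain ⟨φ, hφ, hz⟩ := hA (e ∘ f ∘ ψ) (q b) (hinj.comp hψ.injective) (fun n => (he _).1)
    (((hq.continuous.tendsto b).comp hlim).congr hy)
  -- The sequence approaching the `n`-th point avoids `q '' K n`, so no choice of tails can have its
  -- union inside a single `q '' K m`.
  have hseq : ∀ n, ∃ z : ℕ → X, (∀ j, z j ∉ q '' K n) ∧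
      Tendsto z atTop (𝓝 (e (f (ψ (φ n))))) := by
    intro n
    have hn : e (f (ψ (φ n))) ∉ typePoints q K n := fun hmem =>
      het _ (typePoints_mono q K (((hfm.comp hψ).comp hφ).le_apply (x := n)) hmem)
    simp only [typePoints, mem_ofPred_eq, not_forall, not_not] at hn
    obtain ⟨M, hM⟩ := hn
    obtain ⟨z, hz, hzlim⟩ := exists_seq_tendsto_of_mem_closure_image hq.continuous
      (K.isCompact M) sdiff_subset hM
    exact ⟨z, fun j => (hz j).2, hzlim⟩
  choose z hzK hzlim using hseq
  obtain ⟨k, hk⟩ := hz z hzlim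
  obtain ⟨m, hm⟩ := exists_subset_image_of_isCompact hq K hk
  exact hzK m (k m) (hm (subset_closure ⟨m, k m, le_rfl, rfl⟩))

/-- The terms eventually lie in `q '' K p`, so they share a type bound `r`. A term not of type `p`
is then in the closure of `q '' K r \ q '' K p`; if this happened frequently, so would be the limit
`a`. -/
theorem eventually_mem_typePoints [FirstCountableTopology Y] [T2Space Y] (hq : IsQuotientMap q)
    (hE : ∀ x ∈ E, IsCompactTypePoint x) (hA : PropertyA E) {p : ℕ} {a : X}
    (ha : a ∈ typePoints q K p) {x : ℕ → X} (hxE : ∀ n, x n ∈ E) (hx : Tendsto x atTop (𝓝 a)) :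
    ∀ᶠ n in atTop, x n ∈ typePoints q K p := by
  obtain ⟨r, hr⟩ := hA.exists_inter_image_subset_typePoints K hq hE p
  by_contra h
  refine ha r (isClosed_closure.mem_of_frequently_of_tendsto ?_ hx)
  refine ((not_eventually.1 h).and_eventually
    (eventually_mem_image_of_mem_typePoints K hq ha hx)).mono fun n hn => ?_
  have hnr : x n ∈ typePoints q K r := hr ⟨hxE n, hn.2⟩
  have hn1 := hn.1
  simp only [typePoints, mem_ofPred_eq, not_forall, not_not] at hn1
  obtain ⟨M, hM⟩ := hn1
  have hsub : q '' K M \ q '' K p ⊆ (q '' K M \ q '' K r) ∪ (q '' K r \ q '' K p) := by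
    intro w hw
    by_cases hwr : w ∈ q '' K r
    · exact Or.inr ⟨hwr, hw.2⟩
    · exact Or.inl ⟨hw.1, hwr⟩
  have hM' := closure_mono hsub hM
  rw [closure_union] at hM'
  exact hM'.resolve_left (hnr M)

/-- By property (b), every sequence that converges to a point of bounded type in the closure of
the points of `E` of that type is eventually contained in this closure. -/
theorem PropertyB.eventually_mem_closure [FirstCountableTopology Y] [T2Space Y]
    (hq : IsQuotientMap q) (hE : ∀ x ∈ E, IsCompactTypePoint x) (hA : PropertyA E)
    (hB : PropertyB E) {p : ℕ} {a : X} (ha : a ∈ typePoints q K p)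
    (ha' : a ∈ closure (E ∩ typePoints q K p)) {x : ℕ → X} (hx : Tendsto x atTop (𝓝 a)) :
    ∀ᶠ n in atTop, x n ∈ closure (E ∩ typePoints q K p) := by
  by_contra h
  obtain ⟨ψ, hψ, hinj, hψx⟩ := exists_injective_subseq hx
    (P := fun b => b ∉ closure (E ∩ typePoints q K p)) (not_eventually.1 h) (not_not.2 ha')
  obtain ⟨φ, hφ, z, hzE, hz, hdiag⟩ := hB (x ∘ ψ) a hinj (hx.comp hψ.tendsto_atTop)
  -- Terms outside the closure are approximated from `E` by points not of type `p`; a diagonal of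
  -- these converges to `a`, against `eventually_mem_typePoints`.
  have hex : ∀ n, ∃ j, z n j ∉ typePoints q K p := by
    intro n
    by_contra! hn
    exact hψx (φ n) (mem_closure_of_tendsto (hz n)
      (Eventually.of_forall fun j => ⟨hzE n j, hn j⟩))
  choose j hj using hex
  obtain ⟨n, hn⟩ := (eventually_mem_typePoints K hq hE hA ha (fun n => hzE n (j n))
    (hdiag j)).exists
  exact hj n hn

/-- The points of `X` whose `q_*`-fibre consists of their `q`-fibre only. -/
def starSingletons (q : Y → X) : Set X :=
  {x | ∀ F : fellStar q, qStar q F = x → F.1.toSet = q ⁻¹' {x}}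

/-- Generic points of the closure of `E ∩ typePoints q K p` have singleton fibres in `Y_*`. -/
theorem closure_inter_typePoints_subset (hY : IsStandardSpace Y) (hq : IsQuotientMap q)
    (hE : ∀ x ∈ E, IsCompactTypePoint x) (hA : PropertyA E) (hB : PropertyB E) (p : ℕ) :
    closure (E ∩ typePoints q K p) ⊆ closure (starSingletons q ∩ q '' K p) := by
  have := hY.locallyCompact
  have := hY.metrizable
  have := hY.secondCountable
  obtain ⟨𝒞, h𝒞, hcomp, hbase⟩ := exists_countable_compact_nhds Y
  set A := closure (E ∩ typePoints q K p)
  have hAK : A ⊆ q '' K p := closure_minimal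
    (inter_subset_right.trans (typePoints_subset_image K hq p))
    ((K.isCompact p).image hq.continuous).isClosed
  have : CompactSpace A := isCompact_iff_compactSpace.1
    (((K.isCompact p).image hq.continuous).of_isClosed_subset isClosed_closure hAK)
  have hEA : Dense ((↑) ⁻¹' (E ∩ typePoints q K p) : Set A) := by
    intro a
    rw [closure_subtype, Subtype.image_preimage_coe, inter_eq_right.2 subset_closure]
    exact a.2
  have htype : Dense (⋂ M, ((↑) ⁻¹' closure (q '' K M \ q '' K p) : Set A)ᶜ) :=
    hEA.mono fun a ha => mem_iInter.2 fun M => ha.2 M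
  have hcl : ∀ C ∈ 𝒞, IsClosed ((↑) ⁻¹' (q '' C) : Set A) := fun C hC =>
    ((hcomp C hC).image hq.continuous).isClosed.preimage continuous_subtype_val
  have hfront : Dense (⋂ C ∈ 𝒞, (frontier ((↑) ⁻¹' (q '' C) : Set A))ᶜ) :=
    dense_biInter_of_isOpen (fun C _ => isClosed_frontier.isOpen_compl) h𝒞 fun C hC =>
      interior_eq_empty_iff_dense_compl.1 (interior_frontier (hcl C hC))
  have hG : Dense ((⋂ M, ((↑) ⁻¹' closure (q '' K M \ q '' K p) : Set A)ᶜ) ∩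
      ⋂ C ∈ 𝒞, (frontier ((↑) ⁻¹' (q '' C) : Set A))ᶜ) :=
    htype.inter_of_Gδ
      (IsGδ.iInter fun M => (isClosed_closure.preimage continuous_subtype_val).isOpen_compl.isGδ)
      (IsGδ.biInter h𝒞 fun C _ => isClosed_frontier.isOpen_compl.isGδ) hfront
  have hgood : ∀ a : A, a ∈ ((⋂ M, ((↑) ⁻¹' closure (q '' K M \ q '' K p) : Set A)ᶜ) ∩
      ⋂ C ∈ 𝒞, (frontier ((↑) ⁻¹' (q '' C) : Set A))ᶜ) → (a : X) ∈ starSingletons q := by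
    rintro a ⟨ha1, ha2⟩ F hF
    have hatype : (a : X) ∈ typePoints q K p := fun M => mem_iInter.1 ha1 M
    refine Subset.antisymm (fun y hy => ?_) fun y hy => ?_
    · exact (qStar_eq hq.continuous F hy).symm.trans hF
    · by_contra hyF
      obtain ⟨C, hC, hyC, hCF⟩ :=
        hbase y F.1.toSetᶜ F.1.isClosed_toSet.isOpen_compl hyF
      -- Since `a` is off the frontier, `q '' C` is a neighbourhood of `a` relative to `A`. The base
      -- points `q (w n)` eventually lie in `A`, so their fibres meet `C`, although `F` misses `C`.
      have haint : a ∈ interior ((↑) ⁻¹' (q '' C) : Set A) := by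
        have h1 : a ∈ ((↑) ⁻¹' (q '' C) : Set A) := ⟨y, interior_subset hyC, hy⟩
        by_contra h2
        exact mem_iInter₂.1 ha2 C hC ⟨subset_closure h1, h2⟩
      obtain ⟨O, hO, hOC⟩ := mem_nhds_subtype A a _ |>.1 (mem_interior_iff_mem_nhds.1 haint)
      obtain ⟨w, hw, hqw⟩ := exists_seq_fibres_tendsto hY hq.continuous F
      rw [hF] at hqw
      have hmiss := hw.eventually ((FellCloseds.isOpen_miss (hcomp C hC)).mem_nhds
        (show F.1.toSet ∩ C = ∅ from eq_empty_of_forall_notMem fun z hz => hCF hz.2 hz.1))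
      obtain ⟨n, ⟨hnA, hnO⟩, hn⟩ := (((hB.eventually_mem_closure K hq hE hA hatype a.2 hqw).and
        (hqw.eventually hO)).and hmiss).exists
      obtain ⟨c, hc, hcw⟩ := @hOC ⟨q (w n), hnA⟩ hnO
      exact (eq_empty_iff_forall_notMem.1 hn) c ⟨hcw, hc⟩
  intro a ha
  have h1 := hG ⟨a, ha⟩
  rw [closure_subtype] at h1
  refine closure_mono ?_ h1
  rintro _ ⟨b, hb, rfl⟩
  exact ⟨hgood b hb, hAK b.2⟩

end

/-! ### The restriction of `q_*` to the closure of its singleton fibres -/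

/-- The image under `q_*` of the elements of `singletonClosure q` that meet `C`. -/
def starImage (q : Y → X) (C : Set Y) : Set X :=
  qStar q '' (singletonClosure q ∩ {F | (F.1.toSet ∩ C).Nonempty})

theorem isCompact_singletonClosure_inter_hit {X : Type*} {q : Y → X} {C : Set Y}
    (hC : IsCompact C) :
    IsCompact (singletonClosure q ∩ {F | (F.1.toSet ∩ C).Nonempty}) := by
  -- Meeting the compact set `C` is a closed condition that excludes the empty set, so compactness
  -- passes from the hyperspace to `Y_*`.
  have h1 : IsCompact (closure (fibreSet q) ∩ {F : FellCloseds Y | (F.toSet ∩ C).Nonempty}) :=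
    (isClosed_closure.inter (FellCloseds.isClosed_hit hC)).isCompact
  have h2 : IsCompact {F : fellStar q | (F.1.toSet ∩ C).Nonempty} := by
    rw [Subtype.isCompact_iff]
    convert h1 using 1
    ext F
    constructor
    · rintro ⟨G, hG, rfl⟩
      exact ⟨G.2.1, hG⟩
    · rintro ⟨hF, hFC⟩
      exact ⟨⟨F, hF, hFC.mono inter_subset_left⟩, hFC, rfl⟩
  exact h2.inter_left isClosed_closure

variable [T2Space X] (K : CompactExhaustion Y) {E : Set X}

theorem starSingletons_inter_subset_starImage (hq : IsQuotientMap q) (C : Set Y) :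
    starSingletons q ∩ q '' C ⊆ starImage q C := by
  rintro _ ⟨hx, y, hy, rfl⟩
  refine ⟨fibreStar hq.continuous y, ⟨subset_closure ?_, ⟨y, rfl, hy⟩⟩,
    qStar_fibreStar hq.continuous y⟩
  refine Subset.antisymm (fun F hF => ?_) (by rintro _ rfl; rfl)
  refine Subtype.ext (FellCloseds.ext_toSet (hx F ?_))
  exact (show qStar q F = _ from hF).trans (qStar_fibreStar hq.continuous y)

theorem inter_typePoints_subset_starImage (hY : IsStandardSpace Y) (hq : IsQuotientMap q)
    (hE : ∀ x ∈ E, IsCompactTypePoint x) (hA : PropertyA E) (hB : PropertyB E) (p : ℕ) :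
    E ∩ typePoints q K p ⊆ starImage q (K p) := by
  have hcl : IsClosed (starImage q (K p)) :=
    ((isCompact_singletonClosure_inter_hit (K.isCompact p)).image
      (continuous_qStar hq.continuous)).isClosed
  exact (subset_closure.trans (closure_inter_typePoints_subset K hY hq hE hA hB p)).trans
    (closure_minimal (starSingletons_inter_subset_starImage hq _) hcl)

theorem exists_inter_image_subset_starImage (hY : IsStandardSpace Y) (hq : IsQuotientMap q)
    (hE : ∀ x ∈ E, IsCompactTypePoint x) (hA : PropertyA E) (hB : PropertyB E) (p : ℕ) :
    ∃ r, E ∩ q '' K p ⊆ starImage q (K r) := by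
  have := hY.metrizable
  obtain ⟨r, hr⟩ := hA.exists_inter_image_subset_typePoints K hq hE p
  exact ⟨r, fun x hx =>
    inter_typePoints_subset_starImage K hY hq hE hA hB r ⟨hx.1, hr hx⟩⟩

theorem surjective_domRestrict_qStar (hY : IsStandardSpace Y) (hq : IsQuotientMap q)
    (hdense : SequentiallyDense E) (hE : ∀ x ∈ E, IsCompactTypePoint x) (hA : PropertyA E)
    (hB : PropertyB E) :
    Function.Surjective ((singletonClosure q).domRestrict (qStar q)) := by
  have := hY.locallyCompact
  have := hY.secondCountable
  intro x
  let K := CompactExhaustion.choice Y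
  obtain ⟨s, hsE, hs⟩ := hdense x
  obtain ⟨p, -, hp⟩ := exists_forall_mem_image_of_tendsto hq K hs
  obtain ⟨r, hr⟩ := exists_inter_image_subset_starImage K hY hq hE hA hB p
  have hcl : IsClosed (starImage q (K r)) :=
    ((isCompact_singletonClosure_inter_hit (K.isCompact r)).image
      (continuous_qStar hq.continuous)).isClosed
  obtain ⟨F, hF, hFx⟩ := hcl.mem_of_tendsto hs
    (Eventually.of_forall fun n => hr ⟨hsE n, hp n⟩)
  exact ⟨⟨F, hF.1⟩, hFx⟩

/-- An injective convergent sequence in `X` meets the `q_*`-image of a compact part of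
`singletonClosure q` infinitely often. -/
theorem exists_frequently_mem_starImage (hY : IsStandardSpace Y) (hq : IsQuotientMap q)
    (hE : ∀ x ∈ E, IsCompactTypePoint x) (hA : PropertyA E) (hB : PropertyB E) {x : ℕ → X}
    {a : X} (hinj : Function.Injective x) (hx : Tendsto x atTop (𝓝 a)) :
    ∃ r, ∃ᶠ n in atTop, x n ∈ starImage q (K r) := by
  obtain ⟨φ, hφ, z, hzE, hz, hdiag⟩ := hB x a hinj hx
  -- Otherwise some diagonal leaves every `q '' K m`, although it converges. The value `0` off the
  -- range of `ψ` is arbitrary.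
  obtain ⟨p, hp⟩ : ∃ p, ∀ᶠ n in atTop, ∀ j, z n j ∈ q '' K p := by
    by_contra! h
    obtain ⟨ψ, hψ, hψz⟩ := extraction_forall_of_frequently h
    choose j hj using hψz
    obtain ⟨m, -, hm⟩ := exists_forall_mem_image_of_tendsto hq K
      (hdiag (Function.extend ψ j 0))
    have hmm := hm (ψ m)
    rw [hψ.injective.extend_apply] at hmm
    exact hj m hmm
  obtain ⟨r, hr⟩ := exists_inter_image_subset_starImage K hY hq hE hA hB p
  have hcl : IsClosed (starImage q (K r)) :=
    ((isCompact_singletonClosure_inter_hit (K.isCompact r)).image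
      (continuous_qStar hq.continuous)).isClosed
  refine ⟨r, hφ.tendsto_atTop.frequently (Eventually.frequently ?_)⟩
  filter_upwards [hp] with n hn
  exact hcl.mem_of_tendsto (hz n) (Eventually.of_forall fun j => hr ⟨hzE n j, hn j⟩)

theorem isQuotientMap_domRestrict_qStar (hY : IsStandardSpace Y) (hq : IsQuotientMap q)
    (hdense : SequentiallyDense E) (hE : ∀ x ∈ E, IsCompactTypePoint x) (hA : PropertyA E)
    (hB : PropertyB E) : IsQuotientMap ((singletonClosure q).domRestrict (qStar q)) := by
  have := hY.locallyCompact
  have := hY.metrizable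
  have := hY.secondCountable
  have := hq.sequentialSpace
  let K := CompactExhaustion.choice Y
  have hcont := continuous_qStar hq.continuous
  refine isQuotientMap_iff_isClosed.2
    ⟨surjective_domRestrict_qStar hY hq hdense hE hA hB, fun A =>
      ⟨fun hcl => hcl.preimage (hcont.comp continuous_subtype_val), fun hcl => ?_⟩⟩
  have hinter : ∀ r, IsClosed (A ∩ starImage q (K r)) := by
    intro r
    have h1 : IsClosed (singletonClosure q ∩ qStar q ⁻¹' A) := by
      have hV : IsClosed (singletonClosure q) := isClosed_closure
      have h2 := hV.isClosedMap_subtype_val _ hcl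
      rwa [show Set.domRestrict (singletonClosure q) (qStar q) ⁻¹' A =
        Subtype.val ⁻¹' (qStar q ⁻¹' A) from rfl, Subtype.image_preimage_coe] at h2
    have h3 := (((isCompact_singletonClosure_inter_hit (K.isCompact r)).inter_right
      h1).image hcont).isClosed
    convert h3 using 1
    ext x
    constructor
    · rintro ⟨hxA, F, ⟨hFV, hFK⟩, rfl⟩
      exact ⟨F, ⟨⟨hFV, hFK⟩, hFV, hxA⟩, rfl⟩
    · rintro ⟨F, ⟨hF, -, hFA⟩, rfl⟩
      exact ⟨hFA, F, hF, rfl⟩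
  -- As a quotient of a metrizable space, `X` is sequential, so sequences suffice; a limit outside
  -- `A` allows an injective subsequence.
  refine IsSeqClosed.isClosed fun x a hxA hx => ?_
  by_contra ha
  obtain ⟨ψ, hψ, hinj, hψA⟩ := exists_injective_subseq hx
    (P := fun b => b ∈ A) (Eventually.of_forall hxA).frequently ha
  have hlim := hx.comp hψ.tendsto_atTop
  obtain ⟨r, hr⟩ := exists_frequently_mem_starImage K hY hq hE hA hB hinj hlim
  exact ha ((hinter r).mem_of_frequently_of_tendsto (hr.mono fun n hn => ⟨hψA n, hn⟩) hlim).1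

/-- A closed set that the restriction of a map to the closure of its singleton fibres maps onto
the codomain is everything. -/
theorem eq_univ_of_image_domRestrict_closure {Z : Type*} {W : Type*} [TopologicalSpace Z]
    {f : Z → W} :
    ∀ C : Set (closure (singletonFibres f)), IsClosed C →
      (closure (singletonFibres f)).domRestrict f '' C = univ → C = univ := by
  intro C hC hCf
  have hsub : singletonFibres f ⊆ Subtype.val '' C := by
    intro z hz
    obtain ⟨w, hw, hwz⟩ := hCf.symm ▸ mem_univ (f z)
    have hwz' : (w : Z) ∈ f ⁻¹' {f z} := hwz
    rw [show f ⁻¹' {f z} = {z} from hz] at hwz'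
    exact ⟨w, hw, hwz'⟩
  have hcl := closure_minimal hsub (isClosed_closure.isClosedMap_subtype_val _ hC)
  refine eq_univ_of_forall fun w => ?_
  obtain ⟨w', hw', h⟩ := hcl w.2
  exact Subtype.ext h ▸ hw'

end SingletonClosure

/-! ### The equivalence of the three conditions. -/

theorem corollary5p5 {X : Type u} [TopologicalSpace X] [T2Space X]
    (hX : ∃ (Y : Type v) (_ : TopologicalSpace Y) (q : Y → X),
      IsStandardSpace Y ∧ IsQuotientMap q) :
    List.TFAE [
      ∃ (Y : Type v) (_ : TopologicalSpace Y) (q : Y → X),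
        IsStandardSpace Y ∧ IsQuotientMap q ∧ IsIrreducibleMap q,
      ∃ E : Set X, SequentiallyDense E ∧ (∀ x ∈ E, IsCompactTypePoint x) ∧
        PropertyA E ∧ PropertyB E,
      ∀ (Y : Type v) [TopologicalSpace Y] (q : Y → X), IsStandardSpace Y → IsQuotientMap q →
        IsQuotientMap ((singletonClosure q).domRestrict (qStar q)) ∧
          IsIrreducibleMap ((singletonClosure q).domRestrict (qStar q))] := by
  tfae_have 1 → 2 := by
    rintro ⟨Y, _, q, hY, hq, hirr⟩
    have := hY.locallyCompact
    have := hY.metrizable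
    have := hY.secondCountable
    have hdense := dense_singletonFibres hq.continuous hirr
    let K := CompactExhaustion.choice Y
    refine ⟨q '' singletonFibres q, sequentiallyDense_image hq.continuous hq.surjective hdense,
      ?_, propertyA_image_singletonFibres hq K, propertyB_image_of_dense hq K hdense⟩
    rintro _ ⟨y, hy, rfl⟩
    exact isCompactTypePoint_of_mem_singletonFibres hq K hy
  tfae_have 2 → 3 := by
    rintro ⟨E, hdense, hE, hA, hB⟩ Y _ q hY hq
    have hsurj := surjective_domRestrict_qStar hY hq hdense hE hA hB
    exact ⟨isQuotientMap_domRestrict_qStar hY hq hdense hE hA hB, hsurj,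
      eq_univ_of_image_domRestrict_closure⟩
  tfae_have 3 → 1 := by
    intro h
    obtain ⟨Y, _, q, hY, hq⟩ := hX
    obtain ⟨h1, h2⟩ := h Y q hY hq
    exact ⟨singletonClosure q, inferInstance, _,
      isStandardSpace_of_isClosed_fellStar hY isClosed_closure, h1, h2⟩
  tfae_finish
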